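/- **Setting.** Fix countably infinite, disjoint sets of constants, labelled nulls and variables. A schema is a finite set of relation symbols, each with an arity $\ge 0$; its width $\mathrm{wd}$ is the maximum arity of its symbols. A fact is an atom all of whose arguments are constants; an instance is a (possibly infinite) set of atoms over constants and nulls; an $\mathbf S$-database is a finite set of facts over the schema $\mathbf S$. The active domain $\mathrm{adom}(D)$ is the set of constants occurring in $D$. The tree-width $\mathrm{tw}(D)$ is the minimal width of a tree decomposition of $D$ (bags are subsets of $\mathrm{adom}(D)$, every fact of $D$ has all its arguments in some bag, the nodes whose bags contain a given $a\in\mathrm{adom}(D)$ induce a connected subtree), where the width is the maximum size of a bag minus one. A TGD is a sentence $\forall \bar x\,\forall\bar y\,(\varphi(\bar x,\bar y)\to\exists\bar z\,\psi(\bar x,\bar z))$ with $\varphi,\psi$ conjunctions of constant-free atoms; it is guarded if some atom of $\varphi$ contains all variables of $\varphi$. For a finite set $\mathcal O$ of TGDs, $\mathrm{sig}(\mathcal O)$ is the set of relation symbols occurring in $\mathcal O$. For a set $F$ of facts and a fact $\alpha$, $(F,\mathcal O)\models\alpha$ means that $\alpha\in J$ for every instance $J\supseteq F$ that satisfies all TGDs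 of $\mathcal O$. A query $Q\in(\mathbb G,\mathbb{AQ}_0)$ is a triple $Q=(\mathbf S,\mathcal O,P)$ with $\mathbf S$ a non-empty schema (the data schema), $\mathcal O$ a finite set of guarded TGDs and $P\in\mathbf S\cup\mathrm{sig}(\mathcal O)$ a $0$-ary relation symbol. For an $\mathbf S$-database $D$, write $D\models Q$ if $(D,\mathcal O)\models P()$. Let $w=\mathrm{wd}(\mathbf S\cup\mathrm{sig}(\mathcal O))$ and $k_Q=|\mathbf S\cup\mathrm{sig}(\mathcal O)|\cdot w^{w}$ (with $0^0=1$). A *derivation tree* for $D$ and $Q$ is a finite rooted tree in which every node has at most $k_Q$ children and every node $v$ is labelled by a fact $\eta(v)$ over $\mathbf S\cup\mathrm{sig}(\mathcal O)$ with arguments in $\mathrm{adom}(D)$, such that (1) $\eta(v)=P()$ for the root $v$; (2) $\eta(v)\in D$ for every leaf $v$; (3) $(\{\eta(u_1),\dots,\eta(u_k)\},\mathcal O)\models\eta(v)$ for every non-leaf node $v$ with children $u_1,\dots,u_k$. Its height is the maximum number of edges on a path from the root to a leaf. For $D\models Q$, $\mathrm{cost}(D,Q)$ is the minimal height of a derivation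 tree for $D$ and $Q$ (and $\infty$ should there be none), and $$\mathrm{cost}(Q)=\sup\{\mathrm{cost}(D,Q)\mid D\text{ is an }\mathbf S\text{-database},\ D\models Q,\ \mathrm{tw}(D)\le\max\{0,\mathrm{wd}(\mathbf S)-1\}\}\in\mathbb N\cup\{\infty\},\qquad \sup\emptyset=0.$$ **Theorem.** Let $Q\in(\mathbb G,\mathbb{AQ}_0)$ have data schema $\mathbf S$. The following are equivalent: 1. There is a $k\ge 0$ such that, for every $\mathbf S$-database $D$ of tree-width at most $\max\{0,\mathrm{wd}(\mathbf S)-1\}$, if $D\models Q$, then there is a $D'\subseteq D$ with at most $k$ facts such that $D'\models Q$. 2. $\mathrm{cost}(Q)$ is finite. -/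

import Mathlib

universe u

namespace GuardedOMQ

/-- Constants: a countably infinite set. -/
abbrev Const : Type := ℕ

/-- Labelled nulls: a countably infinite set. -/
abbrev Null : Type := ℕ

/-- Variables: a countably infinite set. -/
abbrev Var : Type := ℕ

/-- Atoms `r(v₁, …, vₙ)` with arguments in `τ`, where `ar r = n` is the arity of `r`. -/
structure Atom {R : Type u} (ar : R → ℕ) (τ : Type) where
  rel : R
  args : Fin (ar rel) → τ

/-- Apply a map to all arguments of an atom. -/
def Atom.map {R : Type u} {ar : R → ℕ} {σ τ : Type} (f : σ → τ) (α : Atom ar σ) : Atom ar τ :=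
  ⟨α.rel, fun i => f (α.args i)⟩

/-- The finite set of arguments of an atom over constants or variables. -/
def Atom.argSet {R : Type u} {ar : R → ℕ} (α : Atom ar ℕ) : Finset ℕ :=
  Finset.univ.image α.args

/-- A fact is an atom all of whose arguments are constants. -/
abbrev Fact {R : Type u} (ar : R → ℕ) : Type u := Atom ar Const

/-- An instance is a (possibly infinite) set of atoms over constants and nulls. -/
abbrev Inst {R : Type u} (ar : R → ℕ) : Type u := Set (Atom ar (Const ⊕ Null))

/-- A database is a finite set of facts. -/
abbrev Database {R : Type u} (ar : R → ℕ) : Type u := Finset (Fact ar)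

/-- All relation symbols of `D` belong to the schema `S`. -/
def Database.IsOver {R : Type u} {ar : R → ℕ} (D : Database ar) (S : Finset R) : Prop :=
  ∀ α ∈ D, α.rel ∈ S

/-- The active domain of a database. -/
def Database.adom {R : Type u} {ar : R → ℕ} (D : Database ar) : Finset Const :=
  D.biUnion Atom.argSet

/-- The width of a schema: the maximum arity of its relation symbols. -/
def schemaWidth {R : Type u} (ar : R → ℕ) (S : Finset R) : ℕ := S.sup ar

/-! ### Tree-width -/

/-- A tree decomposition of a database. -/
structure TreeDecomposition {R : Type u} {ar : R → ℕ} (D : Database ar) where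
  Node : Type
  tree : SimpleGraph Node
  isTree : tree.IsTree
  bag : Node → Finset Const
  bag_subset : ∀ t, bag t ⊆ D.adom
  covers : ∀ α ∈ D, ∃ t, α.argSet ⊆ bag t
  connected : ∀ a ∈ D.adom, (tree.induce {t | a ∈ bag t}).Connected

/-- The width: maximum bag size minus one (an integer, as all bags may be empty). -/
noncomputable def TreeDecomposition.width {R : Type u} {ar : R → ℕ} {D : Database ar}
    (δ : TreeDecomposition D) : ℤ :=
  ((⨆ t, (δ.bag t).card : ℕ) : ℤ) - 1

/-- The tree-width: the least width of a tree decomposition. -/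
noncomputable def treeWidth {R : Type u} {ar : R → ℕ} (D : Database ar) : ℤ :=
  sInf {n : ℤ | ∃ δ : TreeDecomposition D, δ.width = n}

/-- The tree decomposition with a single bag. -/
def TreeDecomposition.single {R : Type u} {ar : R → ℕ} (D : Database ar) :
    TreeDecomposition D where
  Node := Unit
  tree := ⊥
  isTree := SimpleGraph.IsTree.of_subsingleton
  bag _ := D.adom
  bag_subset _ := Finset.Subset.refl _
  covers α hα := ⟨(), Finset.subset_biUnion_of_mem Atom.argSet hα⟩
  connected a ha := by
    have : Nonempty {t : Unit | a ∈ D.adom} := ⟨⟨(), ha⟩⟩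
    exact ⟨SimpleGraph.Preconnected.of_subsingleton⟩

/-- The minimum in the definition of tree-width is attained. -/
theorem exists_width_eq_treeWidth {R : Type u} {ar : R → ℕ} (D : Database ar) :
    ∃ δ : TreeDecomposition D, δ.width = treeWidth D := by
  have h : treeWidth D ∈ {n : ℤ | ∃ δ : TreeDecomposition D, δ.width = n} := by
    refine Int.csInf_mem ⟨_, TreeDecomposition.single D, rfl⟩ ⟨-1, ?_⟩
    rintro n ⟨δ, rfl⟩
    unfold TreeDecomposition.width
    omega
  exact h

/-- Tree-width at most `n` means that some tree decomposition has all bags of size at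
most `n + 1`. -/
theorem treeWidth_le_iff {R : Type u} {ar : R → ℕ} (D : Database ar) (n : ℕ) :
    treeWidth D ≤ n ↔ ∃ δ : TreeDecomposition D, ∀ t, (δ.bag t).card ≤ n + 1 := by
  constructor
  · intro h
    obtain ⟨δ, hδ⟩ := exists_width_eq_treeWidth D
    refine ⟨δ, fun t => ?_⟩
    have hb : BddAbove (Set.range fun t => (δ.bag t).card) :=
      ⟨D.adom.card, by rintro _ ⟨s, rfl⟩; exact Finset.card_le_card (δ.bag_subset s)⟩
    have h1 := le_ciSup hb t
    unfold TreeDecomposition.width at hδ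
    omega
  · rintro ⟨δ, hδ⟩
    have : Nonempty δ.Node := δ.isTree.connected.nonempty
    have h1 : (⨆ t, (δ.bag t).card) ≤ n + 1 := ciSup_le hδ
    have h2 : treeWidth D ≤ δ.width := by
      refine csInf_le ⟨-1, ?_⟩ ⟨δ, rfl⟩
      rintro m ⟨ε, rfl⟩
      unfold TreeDecomposition.width
      omega
    unfold TreeDecomposition.width at h2
    omega

/-! ### Tuple-generating dependencies -/

/-- A tuple-generating dependency `φ(x,y) → ∃ z, ψ(x,z)`: `body` and `head` are the sets of
conjuncts of `φ` and `ψ`, and `x` consists of the variables they share. -/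
structure TGD {R : Type u} (ar : R → ℕ) where
  body : Finset (Atom ar Var)
  head : Finset (Atom ar Var)

/-- The variables occurring in a conjunction of atoms. -/
def varsOf {R : Type u} {ar : R → ℕ} (φ : Finset (Atom ar Var)) : Finset Var :=
  φ.biUnion Atom.argSet

/-- The frontier: the body variables that also occur in the head. -/
def TGD.frontier {R : Type u} {ar : R → ℕ} (τ : TGD ar) : Finset Var :=
  varsOf τ.body ∩ varsOf τ.head

/-- `J ⊨ τ`: every homomorphism of the body into `J` agrees on the frontier with some
homomorphism of the head into `J`. -/
def TGD.Sat {R : Type u} {ar : R → ℕ} (J : Inst ar) (τ : TGD ar) : Prop :=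
  ∀ h : Var → Const ⊕ Null, (∀ α ∈ τ.body, α.map h ∈ J) →
    ∃ h' : Var → Const ⊕ Null, (∀ x ∈ τ.frontier, h' x = h x) ∧ ∀ α ∈ τ.head, α.map h' ∈ J

/-- A TGD is guarded if some body atom contains all body variables. -/
def TGD.Guarded {R : Type u} {ar : R → ℕ} (τ : TGD ar) : Prop :=
  ∃ γ ∈ τ.body, varsOf τ.body ⊆ γ.argSet

open scoped Classical in
/-- The relation symbols occurring in a set of TGDs. -/
noncomputable def sig {R : Type u} {ar : R → ℕ} (O : Finset (TGD ar)) : Finset R :=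
  O.biUnion fun τ => (τ.body ∪ τ.head).image Atom.rel

/-- `(F, O) ⊨ α` for a set `F` of facts, a set `O` of TGDs and a fact `α`: the fact `α` belongs
to every instance that includes `F` and satisfies `O`. -/
def Entails {R : Type u} {ar : R → ℕ} (F : Set (Fact ar)) (O : Finset (TGD ar))
    (α : Fact ar) : Prop :=
  ∀ J : Inst ar, (∀ β ∈ F, β.map Sum.inl ∈ J) → (∀ τ ∈ O, τ.Sat J) → α.map Sum.inl ∈ J

/-! ### Ontology-mediated queries -/

open scoped Classical in
/-- An ontology-mediated query `(S, O, P)` whose ontology is a finite set of TGDs and whose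
query is atomic of the form `P()`, with `P` a 0-ary relation symbol from `S ∪ sig(O)`. -/
structure AtomicOMQ {R : Type u} (ar : R → ℕ) where
  dataSchema : Finset R
  dataSchema_nonempty : dataSchema.Nonempty
  ontology : Finset (TGD ar)
  goal : R
  goal_arity : ar goal = 0
  goal_mem : goal ∈ dataSchema ∪ sig ontology

namespace AtomicOMQ

/-- The ontology consists of guarded TGDs. -/
def Guarded {R : Type u} {ar : R → ℕ} (Q : AtomicOMQ ar) : Prop :=
  ∀ τ ∈ Q.ontology, τ.Guarded

open scoped Classical in
/-- The schema `S ∪ sig(O)`. -/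
noncomputable def fullSchema {R : Type u} {ar : R → ℕ} (Q : AtomicOMQ ar) : Finset R :=
  Q.dataSchema ∪ sig Q.ontology

/-- The fact `P()`. -/
def goalFact {R : Type u} {ar : R → ℕ} (Q : AtomicOMQ ar) : Fact ar :=
  ⟨Q.goal, fun i => (Fin.cast Q.goal_arity i).elim0⟩

/-- `D ⊨ Q`. -/
def Holds {R : Type u} {ar : R → ℕ} (Q : AtomicOMQ ar) (D : Database ar) : Prop :=
  Entails (D : Set (Fact ar)) Q.ontology Q.goalFact

/-- The number `max {0, wd(S) - 1}`. -/
def widthBound {R : Type u} {ar : R → ℕ} (Q : AtomicOMQ ar) : ℤ :=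
  max 0 ((schemaWidth ar Q.dataSchema : ℤ) - 1)

/-- There is a `k` such that every database over the data schema `S`, of tree-width at most
`max {0, wd(S) - 1}`, that entails `Q` has a subset of at most `k` facts that entails `Q`. -/
def BoundedSubdatabases {R : Type u} {ar : R → ℕ} (Q : AtomicOMQ ar) : Prop :=
  ∃ k : ℕ, ∀ D : Database ar, D.IsOver Q.dataSchema → treeWidth D ≤ Q.widthBound →
    Q.Holds D → ∃ D' : Database ar, D' ⊆ D ∧ D'.card ≤ k ∧ Q.Holds D'

/-- The branching bound `k_Q = |S ∪ sig(O)| · w ^ w` with `w = wd(S ∪ sig(O))`. -/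
noncomputable def branching {R : Type u} {ar : R → ℕ} (Q : AtomicOMQ ar) : ℕ :=
  Q.fullSchema.card * schemaWidth ar Q.fullSchema ^ schemaWidth ar Q.fullSchema

end AtomicOMQ

/-! ### Derivation trees -/

/-- Finite rooted trees with node labels in `A`; a node with `n = 0` children is a leaf. -/
inductive LTree (A : Type u) : Type u
  | node (a : A) (n : ℕ) (child : Fin n → LTree A) : LTree A

/-- The label of the root. -/
def LTree.label {A : Type u} : LTree A → A
  | .node a _ _ => a

/-- The height: the maximum number of edges on a path from the root to a leaf. -/
def LTree.height {A : Type u} : LTree A → ℕ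
  | .node _ _ child => Finset.univ.sup fun i => (child i).height + 1

namespace AtomicOMQ

/-- The local conditions on derivation trees, at all nodes of the tree: there are at most
`k_Q` children; the label is a fact over `S ∪ sig(O)` and the active domain of `D`; it belongs
to `D` if the node is a leaf, and otherwise it is entailed by `O` and the labels of the
children. -/
def NodesValid {R : Type u} {ar : R → ℕ} (Q : AtomicOMQ ar) (D : Database ar) :
    LTree (Fact ar) → Prop
  | .node α n child =>
      n ≤ Q.branching ∧
      (α.rel ∈ Q.fullSchema ∧ α.argSet ⊆ D.adom) ∧
      (n = 0 → α ∈ D) ∧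
      (n ≠ 0 → Entails (Set.range fun i => (child i).label) Q.ontology α) ∧
      ∀ i, Q.NodesValid D (child i)

/-- Derivation trees for `D` and `Q`. -/
def IsDerivationTree {R : Type u} {ar : R → ℕ} (Q : AtomicOMQ ar) (D : Database ar)
    (T : LTree (Fact ar)) : Prop :=
  T.label = Q.goalFact ∧ Q.NodesValid D T

/-- The cost of `D` with respect to `Q`: the least height of a derivation tree for `D` and `Q`
(it would be `⊤` if there were none). -/
noncomputable def costOn {R : Type u} {ar : R → ℕ} (Q : AtomicOMQ ar) (D : Database ar) : ℕ∞ :=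
  sInf {n : ℕ∞ | ∃ T : LTree (Fact ar), Q.IsDerivationTree D T ∧ n = (T.height : ℕ∞)}

/-- The cost of `Q`: the supremum of the costs of the databases over `S` of tree-width at most
`max {0, wd(S) - 1}` that entail `Q`. -/
noncomputable def cost {R : Type u} {ar : R → ℕ} (Q : AtomicOMQ ar) : ℕ∞ :=
  sSup {c : ℕ∞ | ∃ D : Database ar, Q.Holds D ∧ D.IsOver Q.dataSchema ∧
    treeWidth D ≤ Q.widthBound ∧ c = Q.costOn D}

end AtomicOMQ

end GuardedOMQ

/-!
If a derivation tree of height `h` exists, its leaves form a set of at most `(k_Q + 1) ^ h` facts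
of `D` that already entails the goal (`exists_subset_entails_of_nodesValid`), so finite cost gives
bounded subdatabases.

For the converse, a subdatabase `D'` with at most `k` facts has boundedly many facts over its
active domain. The sets of facts derivable by trees of height at most `n` increase with `n`, hence
become stationary after boundedly many steps (`exists_le_derivable_succ_subset`), and a tree for
`D'` is also a tree for `D`. It remains to see that derivation trees are complete
(`goalFact_mem_of_closed`): a set `F ⊇ D` of facts closed under entailment from at most `k_Q` facts
contains every goal that `D` entails.

To prove completeness, take for the argument set `X` of each fact of `F` the set `A` of all facts
of `F` over `X`; there are at most `k_Q` of them. There is a model `U X` of `A` and the ontology in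
which the facts over `X` are exactly those entailed by `A`. Instead of by the chase, it is obtained
as a finite product of countermodels: TGDs are preserved by products and by inverse images under
surjections, and the latter bring a countable product back to constants and nulls. Glue all the
`U X` along the constants in `X` (`glue`). As a guarded body is matched within a single piece
(`glue_satIn`), the result is a model, and by closure of `F` its facts over the constants are in
`F`.
-/

namespace GuardedOMQ

variable {R : Type u} {ar : R → ℕ}

/-! ### Models over arbitrary domains -/

/-- Satisfaction of a TGD in a set of atoms over an arbitrary domain `V`. For `V = Const ⊕ Null`
this is `TGD.Sat` by definition. -/
def TGD.SatIn {V : Type} (J : Set (Atom ar V)) (τ : TGD ar) : Prop :=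
  ∀ h : Var → V, (∀ α ∈ τ.body, α.map h ∈ J) →
    ∃ h' : Var → V, (∀ x ∈ τ.frontier, h' x = h x) ∧ ∀ α ∈ τ.head, α.map h' ∈ J

theorem Atom.args_mem_argSet (α : Atom ar ℕ) (i : Fin (ar α.rel)) : α.args i ∈ α.argSet :=
  Finset.mem_image_of_mem _ (Finset.mem_univ i)

theorem Atom.argSet_subset_iff {α : Atom ar ℕ} {X : Finset ℕ} :
    α.argSet ⊆ X ↔ ∀ i, α.args i ∈ X := by
  simp [Atom.argSet, Finset.image_subset_iff]

theorem TGD.SatIn.preimage {V W : Type} {J : Set (Atom ar V)} {τ : TGD ar} (hJ : τ.SatIn J)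
    {g : W → V} (hg : Function.Surjective g) : τ.SatIn {α : Atom ar W | α.map g ∈ J} := by
  intro h hb
  obtain ⟨h', hfr, hh⟩ := hJ (g ∘ h) hb
  refine ⟨fun x => if x ∈ τ.frontier then h x else Function.surjInv hg (h' x),
    fun x hx => if_pos hx, fun α hα => ?_⟩
  have key : (g ∘ fun x => if x ∈ τ.frontier then h x else Function.surjInv hg (h' x)) = h' := by
    funext x
    by_cases hx : x ∈ τ.frontier
    · simp [hx, hfr x hx]
    · simp [hx, Function.surjInv_eq hg]
  change α.map (g ∘ fun x => if x ∈ τ.frontier then h x else Function.surjInv hg (h' x)) ∈ J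
  rw [key]
  exact hh α hα

theorem TGD.SatIn.prod {V W : Type} {J : Set (Atom ar V)} {K : Set (Atom ar W)} {τ : TGD ar}
    (hJ : τ.SatIn J) (hK : τ.SatIn K) :
    τ.SatIn {α : Atom ar (V × W) | α.map Prod.fst ∈ J ∧ α.map Prod.snd ∈ K} := by
  intro h hb
  obtain ⟨f, hf, hf'⟩ := hJ (Prod.fst ∘ h) fun α hα => (hb α hα).1
  obtain ⟨g, hg, hg'⟩ := hK (Prod.snd ∘ h) fun α hα => (hb α hα).2
  exact ⟨fun x => (f x, g x), fun x hx => Prod.ext (hf x hx) (hg x hx),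
    fun α hα => ⟨hf' α hα, hg' α hα⟩⟩

theorem surjective_sum_elim {A B V : Type} (c : A → V) {e : B → V} (he : Function.Surjective e) :
    Function.Surjective (Sum.elim c e) := fun v =>
  let ⟨b, hb⟩ := he v
  ⟨Sum.inr b, hb⟩

/-- Entailed facts hold in every countable model, whatever its domain and whatever the
interpretation `c` of the constants, which need not be injective. -/
theorem Entails.map_mem {V : Type} [Countable V] [Nonempty V] {F : Set (Fact ar)}
    {O : Finset (TGD ar)} {α : Fact ar} (h : Entails F O α) (c : Const → V)
    {J : Set (Atom ar V)} (hF : ∀ β ∈ F, β.map c ∈ J) (hO : ∀ τ ∈ O, τ.SatIn J) :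
    α.map c ∈ J := by
  obtain ⟨e, he⟩ := exists_surjective_nat V
  exact h {α | α.map (Sum.elim c e) ∈ J} hF
    fun τ hτ => (hO τ hτ).preimage (surjective_sum_elim c he)

/-- Finitely many facts that are not entailed are avoided by a single model: the product of
countermodels for each of them, with the constants on the diagonal. -/
theorem exists_model_avoiding (A : Set (Fact ar)) (O : Finset (TGD ar)) (S : Finset (Fact ar))
    (hS : ∀ β ∈ S, ¬ Entails A O β) :
    ∃ U : Inst ar, (∀ β ∈ A, β.map Sum.inl ∈ U) ∧ (∀ τ ∈ O, τ.SatIn U) ∧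
      ∀ β ∈ S, β.map Sum.inl ∉ U := by
  classical
  induction S using Finset.induction_on with
  | empty =>
    exact ⟨Set.univ, fun _ _ => trivial, fun τ _ h _ => ⟨h, fun _ _ => rfl, fun _ _ => trivial⟩,
      by simp⟩
  | insert β S _ ih =>
    obtain ⟨U, hUA, hUO, hUS⟩ := ih fun β' h => hS β' (Finset.mem_insert_of_mem h)
    have hβ := hS β (Finset.mem_insert_self _ _)
    simp only [Entails, not_forall] at hβ
    obtain ⟨K, hKA, hKO, hKβ⟩ := hβ
    obtain ⟨e, he⟩ := exists_surjective_nat ((Const ⊕ Null) × (Const ⊕ Null))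
    let g : Const ⊕ Null → (Const ⊕ Null) × (Const ⊕ Null) :=
      Sum.elim (fun a => (Sum.inl a, Sum.inl a)) e
    refine ⟨{α | α.map g ∈ {α : Atom ar ((Const ⊕ Null) × (Const ⊕ Null)) |
        α.map Prod.fst ∈ U ∧ α.map Prod.snd ∈ K}}, fun β' h => ⟨hUA β' h, hKA β' h⟩,
      fun τ hτ => ((hUO τ hτ).prod (hKO τ hτ)).preimage (surjective_sum_elim _ he), ?_⟩
    intro β' hβ' hmem
    rcases Finset.mem_insert.1 hβ' with rfl | h
    · exact hKβ hmem.2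
    · exact hUS β' h hmem.1

/-! ### Facts over a schema and a finite set of constants -/

open scoped Classical in
/-- The finite set of all facts over the schema `S` with arguments in `X`. -/
noncomputable def factsOver (ar : R → ℕ) (S : Finset R) (X : Finset Const) : Finset (Fact ar) :=
  S.biUnion fun r => (Fintype.piFinset fun _ : Fin (ar r) => X).image fun a => ⟨r, a⟩

theorem mem_factsOver {S : Finset R} {X : Finset Const} {α : Fact ar} :
    α ∈ factsOver ar S X ↔ α.rel ∈ S ∧ α.argSet ⊆ X := by
  simp only [factsOver, Finset.mem_biUnion, Finset.mem_image, Fintype.mem_piFinset,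
    Atom.argSet_subset_iff]
  constructor
  · rintro ⟨r, hr, a, ha, rfl⟩
    exact ⟨hr, ha⟩
  · rintro ⟨hr, ha⟩
    exact ⟨α.rel, hr, α.args, ha, rfl⟩

theorem ar_le_schemaWidth {S : Finset R} {r : R} (hr : r ∈ S) : ar r ≤ schemaWidth ar S :=
  Finset.le_sup (f := ar) hr

theorem Atom.card_argSet_le (α : Atom ar ℕ) : α.argSet.card ≤ ar α.rel :=
  Finset.card_image_le.trans (by simp)

theorem card_factsOver_le {S : Finset R} {X : Finset Const} {m : ℕ} (hX : X.card ≤ m)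
    (hm : schemaWidth ar S ≤ m) :
    (factsOver ar S X).card ≤ S.card * m ^ schemaWidth ar S := by
  classical
  refine Finset.card_biUnion_le_card_mul _ _ _ fun r hr => ?_
  refine Finset.card_image_le.trans ?_
  rw [Fintype.card_piFinset_const]
  refine (Nat.pow_le_pow_left hX _).trans ?_
  have hr' : ar r ≤ schemaWidth ar S := ar_le_schemaWidth hr
  rcases Nat.eq_zero_or_pos m with rfl | h
  -- For `m = 0` both exponents vanish, and the convention `0 ^ 0 = 1` applies.
  · simp [Nat.le_zero.1 hm, Nat.le_zero.1 (hr'.trans hm)]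
  · exact Nat.pow_le_pow_right h hr'

theorem rel_mem_sig {O : Finset (TGD ar)} {τ : TGD ar} (hτ : τ ∈ O) {α : Atom ar Var}
    (hα : α ∈ τ.body ∨ α ∈ τ.head) : α.rel ∈ sig O := by
  classical
  unfold sig
  exact Finset.mem_biUnion.2 ⟨τ, hτ, Finset.mem_image_of_mem _ (Finset.mem_union.2 hα)⟩

/-! ### Gluing models along constants -/

/-- The domain of glued models: constants, which are shared, and a private copy of the domain of
`U X` for every set `X` of constants. -/
abbrev GlueDom : Type := Const ⊕ (Finset Const × (Const ⊕ Null))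

/-- The elements of the piece for `X`: the constants in `X` and the private elements of `X`. The
constants in `X` have a duplicate among the private elements, which does no harm. -/
def InPiece (X : Finset Const) : GlueDom → Prop := Sum.elim (· ∈ X) (·.1 = X)

/-- The element of `Const ⊕ Null` that an element of the glued domain stands for. -/
def GlueDom.val : GlueDom → Const ⊕ Null := Sum.elim Sum.inl Prod.snd

/-- The union, over the argument sets `X` of the facts in `F`, of copies of the models `U X`
restricted to the schema `S`. -/
def glue (S : Finset R) (F : Set (Fact ar)) (U : Finset Const → Inst ar) :
    Set (Atom ar GlueDom) :=
  {α | ∃ β ∈ F, α.rel ∈ S ∧ (∀ i, InPiece β.argSet (α.args i)) ∧ α.map GlueDom.val ∈ U β.argSet}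

/-- If the facts over `X` that hold in `U X` are exactly those of `F`, for all argument sets `X` of
facts in `F`, then the glued models satisfy every guarded TGD that all the pieces satisfy. -/
theorem glue_satIn {S : Finset R} {F : Set (Fact ar)} {U : Finset Const → Inst ar} {τ : TGD ar}
    (hU : ∀ β ∈ F, ∀ α : Fact ar, α.rel ∈ S → α.argSet ⊆ β.argSet →
      (α.map Sum.inl ∈ U β.argSet ↔ α ∈ F))
    (hτ : τ.Guarded) (hhead : ∀ α ∈ τ.head, α.rel ∈ S)
    (hsat : ∀ β ∈ F, τ.SatIn (U β.argSet)) : τ.SatIn (glue S F U) := by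
  intro h hb
  obtain ⟨γ, hγ, hγvars⟩ := hτ
  obtain ⟨β, hβ, -, hγin, -⟩ := hb γ hγ
  -- The guard places the whole body in the domain of one piece.
  have hvar : ∀ x ∈ varsOf τ.body, InPiece β.argSet (h x) := by
    intro x hx
    obtain ⟨i, -, rfl⟩ := Finset.mem_image.1 (hγvars hx)
    exact hγin i
  have hbody : ∀ α ∈ τ.body, α.map (GlueDom.val ∘ h) ∈ U β.argSet := by
    intro α hα
    have hαin : ∀ i, InPiece β.argSet (h (α.args i)) := fun i =>
      hvar _ (Finset.mem_biUnion.2 ⟨α, hα, α.args_mem_argSet i⟩)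
    obtain ⟨β', hβ', hαS, hαin', hαU⟩ := hb α hα
    by_cases hinr : ∃ i p, h (α.args i) = Sum.inr p
    -- A private element determines its piece.
    · obtain ⟨i, p, hp⟩ := hinr
      have h1 := hαin i
      have h2 : InPiece β'.argSet (h (α.args i)) := hαin' i
      rw [hp] at h1 h2
      have hβ'' : β'.argSet = β.argSet := Eq.trans (Eq.symm h2) h1
      rw [← hβ'']
      exact hαU
    -- An atom over the constants passes from one piece to the other by way of `F`.
    · have hinl : ∀ i, ∃ a, h (α.args i) = Sum.inl a := fun i => by
        rcases hi : h (α.args i) with a | p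
        · exact ⟨a, rfl⟩
        · exact (hinr ⟨i, p, hi⟩).elim
      choose a ha using hinl
      let δ : Fact ar := ⟨α.rel, a⟩
      have hδ : δ.map Sum.inl = α.map (GlueDom.val ∘ h) := by
        have : (fun i => (Sum.inl (a i) : Const ⊕ Null)) =
            fun i => GlueDom.val (h (α.args i)) := by
          funext i
          rw [ha i]
          rfl
        simp only [δ, Atom.map, Function.comp, this]
      have hδ1 : δ.argSet ⊆ β.argSet := Atom.argSet_subset_iff.2 fun i => by
        have := hαin i
        rwa [ha i] at this
      have hδ2 : δ.argSet ⊆ β'.argSet := Atom.argSet_subset_iff.2 fun i => by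
        have : InPiece β'.argSet (h (α.args i)) := hαin' i
        rwa [ha i] at this
      have hδU : δ.map Sum.inl ∈ U β'.argSet := by
        rw [hδ]
        exact hαU
      rw [← hδ]
      exact (hU β hβ δ hαS hδ1).2 ((hU β' hβ' δ hαS hδ2).1 hδU)
  obtain ⟨h', hfr, hh⟩ := hsat β hβ _ hbody
  refine ⟨fun x => if x ∈ τ.frontier then h x else Sum.inr (β.argSet, h' x),
    fun x hx => if_pos hx, fun α hα => ⟨β, hβ, hhead α hα, fun i => ?_, ?_⟩⟩
  · simp only [Atom.map]
    split_ifs with hx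
    · exact hvar _ (Finset.mem_inter.1 hx).1
    · rfl
  · have key : (GlueDom.val ∘ fun x =>
        if x ∈ τ.frontier then h x else Sum.inr (β.argSet, h' x)) = h' := by
      funext x
      by_cases hx : x ∈ τ.frontier
      · simp [hx, hfr x hx]
      · simp [hx, GlueDom.val]
    change α.map (GlueDom.val ∘ fun x =>
        if x ∈ τ.frontier then h x else Sum.inr (β.argSet, h' x)) ∈ U β.argSet
    rw [key]
    exact hh α hα

namespace AtomicOMQ

theorem dataSchema_subset_fullSchema (Q : AtomicOMQ ar) : Q.dataSchema ⊆ Q.fullSchema := by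
  classical
  unfold fullSchema
  exact Finset.subset_union_left

theorem sig_subset_fullSchema (Q : AtomicOMQ ar) : sig Q.ontology ⊆ Q.fullSchema := by
  classical
  unfold fullSchema
  exact Finset.subset_union_right

theorem argSet_goalFact (Q : AtomicOMQ ar) : Q.goalFact.argSet = ∅ :=
  Finset.subset_empty.1 (Atom.argSet_subset_iff.2 fun i => (Fin.cast Q.goal_arity i).elim0)

/-! ### Completeness of derivation trees -/

/-- A set of facts that includes `D` and is closed under entailment from nonempty sets of at most
`k_Q` of its facts contains the goal if `D` entails it. -/
theorem goalFact_mem_of_closed {Q : AtomicOMQ ar} (hQ : Q.Guarded) {D : Database ar}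
    (hD : D.IsOver Q.dataSchema) (hH : Q.Holds D) {F : Set (Fact ar)}
    (hF : ∀ α ∈ F, α ∈ factsOver ar Q.fullSchema D.adom) (hDF : ∀ α ∈ D, α ∈ F)
    (hcl : ∀ A : Finset (Fact ar), A.Nonempty → A.card ≤ Q.branching → (∀ β ∈ A, β ∈ F) →
      ∀ α ∈ factsOver ar Q.fullSchema D.adom, Entails (A : Set (Fact ar)) Q.ontology α → α ∈ F) :
    Q.goalFact ∈ F := by
  classical
  let A : Finset Const → Finset (Fact ar) := fun X =>
    (factsOver ar Q.fullSchema X).filter (· ∈ F)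
  have hex := fun X => exists_model_avoiding (A X : Set (Fact ar)) Q.ontology
    ((factsOver ar Q.fullSchema X).filter fun β =>
      ¬ Entails (A X : Set (Fact ar)) Q.ontology β) fun β hβ => (Finset.mem_filter.1 hβ).2
  choose U hUA hUO hUS using hex
  have hU : ∀ β ∈ F, ∀ α : Fact ar, α.rel ∈ Q.fullSchema → α.argSet ⊆ β.argSet →
      (α.map Sum.inl ∈ U β.argSet ↔ α ∈ F) := by
    intro β hβ α hα hαβ
    have hβ' := mem_factsOver.1 (hF β hβ)
    have hmem : α ∈ factsOver ar Q.fullSchema β.argSet := mem_factsOver.2 ⟨hα, hαβ⟩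
    refine ⟨fun hαU => ?_, fun hαF => hUA _ α (Finset.mem_filter.2 ⟨hmem, hαF⟩)⟩
    have hent : Entails (A β.argSet : Set (Fact ar)) Q.ontology α := by
      by_contra hn
      exact hUS _ α (Finset.mem_filter.2 ⟨hmem, hn⟩) hαU
    refine hcl (A β.argSet)
      ⟨β, Finset.mem_filter.2 ⟨mem_factsOver.2 ⟨hβ'.1, Finset.Subset.refl _⟩, hβ⟩⟩ ?_
      (fun δ hδ => (Finset.mem_filter.1 hδ).2) α
      (mem_factsOver.2 ⟨hα, hαβ.trans hβ'.2⟩) hent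
    exact (Finset.card_filter_le _ _).trans
      (card_factsOver_le (β.card_argSet_le.trans (ar_le_schemaWidth hβ'.1)) le_rfl)
  have hgoal : Q.goalFact.map Sum.inl ∈ glue Q.fullSchema F U := by
    refine Entails.map_mem hH Sum.inl ?_ fun τ hτ => glue_satIn hU (hQ τ hτ)
      (fun α hα => Q.sig_subset_fullSchema (rel_mem_sig hτ (Or.inr hα)))
      fun β _ => hUO _ τ hτ
    intro β hβ
    have hS : β.rel ∈ Q.fullSchema := Q.dataSchema_subset_fullSchema (hD β hβ)
    exact ⟨β, hDF β hβ, hS, fun i => β.args_mem_argSet i,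
      (hU β (hDF β hβ) β hS (Finset.Subset.refl _)).2 (hDF β hβ)⟩
  obtain ⟨β, hβ, hS, -, hmem⟩ := hgoal
  exact (hU β hβ Q.goalFact hS (by simp [argSet_goalFact])).1 hmem

/-! ### Heights of derivation trees -/

/-- The facts at the roots of trees of height at most `n` that satisfy the local conditions on
derivation trees for `D`. -/
def derivable (Q : AtomicOMQ ar) (D : Database ar) (n : ℕ) : Set (Fact ar) :=
  {α | ∃ T : LTree (Fact ar), T.label = α ∧ Q.NodesValid D T ∧ T.height ≤ n}

theorem derivable_mono (Q : AtomicOMQ ar) (D : Database ar) : Monotone (Q.derivable D) :=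
  fun _ _ hmn _ ⟨T, h1, h2, h3⟩ => ⟨T, h1, h2, h3.trans hmn⟩

theorem mem_factsOver_of_derivable {Q : AtomicOMQ ar} {D : Database ar} {n : ℕ} {α : Fact ar}
    (h : α ∈ Q.derivable D n) : α ∈ factsOver ar Q.fullSchema D.adom := by
  obtain ⟨⟨a, m, c⟩, rfl, hv, -⟩ := h
  rw [NodesValid] at hv
  exact mem_factsOver.2 hv.2.1

theorem mem_derivable_of_mem {Q : AtomicOMQ ar} {D : Database ar} (hD : D.IsOver Q.dataSchema)
    {α : Fact ar} (hα : α ∈ D) (n : ℕ) : α ∈ Q.derivable D n := by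
  refine ⟨.node α 0 Fin.elim0, rfl, ?_, by simp [LTree.height]⟩
  rw [NodesValid]
  exact ⟨Nat.zero_le _, ⟨Q.dataSchema_subset_fullSchema (hD α hα),
    Finset.subset_biUnion_of_mem Atom.argSet hα⟩, fun _ => hα, fun h => (h rfl).elim,
    fun i => i.elim0⟩

theorem mem_derivable_succ {Q : AtomicOMQ ar} {D : Database ar} {n : ℕ} {A : Finset (Fact ar)}
    (hne : A.Nonempty) (hcard : A.card ≤ Q.branching) (hA : ∀ β ∈ A, β ∈ Q.derivable D n)
    {α : Fact ar} (hα : α ∈ factsOver ar Q.fullSchema D.adom)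
    (hent : Entails (A : Set (Fact ar)) Q.ontology α) : α ∈ Q.derivable D (n + 1) := by
  obtain ⟨T₀, -⟩ := hA _ hne.choose_spec
  have : Nonempty (LTree (Fact ar)) := ⟨T₀⟩
  choose! T hlab hval hht using hA
  have hmem : ∀ i, (A.equivFin.symm i : Fact ar) ∈ A := fun i => (A.equivFin.symm i).2
  refine ⟨.node α A.card fun i => T (A.equivFin.symm i), rfl, ?_, ?_⟩
  · rw [NodesValid]
    refine ⟨hcard, mem_factsOver.1 hα, fun h => (hne.card_ne_zero h).elim, fun _ => ?_,
      fun i => hval _ (hmem i)⟩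
    intro J hJ hO
    refine hent J (fun β hβ => ?_) hO
    refine hJ β ⟨A.equivFin ⟨β, hβ⟩, ?_⟩
    simpa using hlab β hβ
  · rw [LTree.height]
    exact Finset.sup_le fun i _ => Nat.succ_le_succ (hht _ (hmem i))

/-- The increasing sets `Q.derivable D n` consist of facts over the active domain, so the number of
those facts bounds the first stationary step. -/
theorem exists_le_derivable_succ_subset (Q : AtomicOMQ ar) (D : Database ar) :
    ∃ n ≤ (factsOver ar Q.fullSchema D.adom).card,
      Q.derivable D (n + 1) ⊆ Q.derivable D n := by
  classical
  by_contra! hcon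
  let G := factsOver ar Q.fullSchema D.adom
  have hgrow : ∀ n ≤ G.card + 1, n ≤ (G.filter (· ∈ Q.derivable D n)).card := by
    intro n
    induction n with
    | zero => simp
    | succ n ih =>
      intro hn
      refine (Nat.succ_le_succ (ih (by omega))).trans (Finset.card_lt_card ?_)
      obtain ⟨α, h1, h2⟩ := Set.not_subset.1 (hcon n (Nat.le_of_succ_le_succ hn))
      refine Finset.ssubset_iff_of_subset (fun β hβ => ?_) |>.2
        ⟨α, Finset.mem_filter.2 ⟨mem_factsOver_of_derivable h1, h1⟩,
          fun h => h2 (Finset.mem_filter.1 h).2⟩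
      have hβ := Finset.mem_filter.1 hβ
      exact Finset.mem_filter.2 ⟨hβ.1, Q.derivable_mono D (Nat.le_succ n) hβ.2⟩
  have h1 := hgrow _ le_rfl
  have h2 := Finset.card_filter_le G (· ∈ Q.derivable D (G.card + 1))
  omega

theorem exists_isDerivationTree {Q : AtomicOMQ ar} (hQ : Q.Guarded) {D : Database ar}
    (hD : D.IsOver Q.dataSchema) (hH : Q.Holds D) :
    ∃ T, Q.IsDerivationTree D T ∧ T.height ≤ (factsOver ar Q.fullSchema D.adom).card := by
  obtain ⟨n, hn, hst⟩ := Q.exists_le_derivable_succ_subset D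
  obtain ⟨T, h1, h2, h3⟩ : Q.goalFact ∈ Q.derivable D n :=
    goalFact_mem_of_closed hQ hD hH (fun _ => mem_factsOver_of_derivable)
      (fun _ hα => mem_derivable_of_mem hD hα n)
      fun _ hne hcard hA _ hα hent => hst (mem_derivable_succ hne hcard hA hα hent)
  exact ⟨T, ⟨h1, h2⟩, h3.trans hn⟩

theorem NodesValid.mono {Q : AtomicOMQ ar} {D D' : Database ar} (hDD : D' ⊆ D)
    {T : LTree (Fact ar)} (h : Q.NodesValid D' T) : Q.NodesValid D T := by
  induction T with
  | node α n child ih =>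
    rw [NodesValid] at h ⊢
    obtain ⟨h1, ⟨h2, h3⟩, h4, h5, h6⟩ := h
    exact ⟨h1, ⟨h2, h3.trans (Finset.biUnion_subset_biUnion_of_subset_left _ hDD)⟩,
      fun h => hDD (h4 h), h5, fun i => ih i (h6 i)⟩

/-- The leaves of a tree that satisfies the local conditions entail its root. -/
theorem exists_subset_entails_of_nodesValid {Q : AtomicOMQ ar} {D : Database ar}
    {T : LTree (Fact ar)} (hT : Q.NodesValid D T) {h : ℕ} (hh : T.height ≤ h) :
    ∃ D' ⊆ D, D'.card ≤ (Q.branching + 1) ^ h ∧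
      Entails (D' : Set (Fact ar)) Q.ontology T.label := by
  classical
  induction T generalizing h with
  | node α n child ih =>
    rw [NodesValid] at hT
    obtain ⟨h1, -, h4, h5, h6⟩ := hT
    rcases Nat.eq_zero_or_pos n with hn | hn
    · refine ⟨{α}, by simpa using h4 hn, by simpa using Nat.one_le_pow _ _ (Nat.succ_pos _), ?_⟩
      exact fun J hJ _ => hJ α (by simp)
    · rw [LTree.height] at hh
      have hch : ∀ i, (child i).height + 1 ≤ h := fun i =>
        (Finset.le_sup (f := fun i => (child i).height + 1) (Finset.mem_univ i)).trans hh
      have hpos : 1 ≤ h := le_trans (Nat.le_add_left _ _) (hch ⟨0, hn⟩)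
      obtain ⟨h, rfl⟩ := Nat.exists_eq_add_of_le' hpos
      choose E hED hEc hEe using fun i => ih i (h6 i) (Nat.le_of_succ_le_succ (hch i))
      refine ⟨Finset.univ.biUnion E, Finset.biUnion_subset.2 fun i _ => hED i, ?_, ?_⟩
      · refine (Finset.card_biUnion_le_card_mul _ _ _ fun i _ => hEc i).trans ?_
        rw [Finset.card_univ, Fintype.card_fin, pow_succ']
        exact Nat.mul_le_mul_right _ (h1.trans (Nat.le_succ _))
      · intro J hJ hO
        refine h5 hn.ne' J ?_ hO
        rintro _ ⟨i, rfl⟩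
        exact hEe i J (fun β hβ => hJ β (Finset.mem_biUnion.2 ⟨i, Finset.mem_univ i, hβ⟩)) hO

theorem card_adom_le {D : Database ar} {S : Finset R} (hD : D.IsOver S) :
    D.adom.card ≤ D.card * schemaWidth ar S :=
  Finset.card_biUnion_le_card_mul _ _ _ fun α hα =>
    α.card_argSet_le.trans (ar_le_schemaWidth (hD α hα))

end AtomicOMQ

end GuardedOMQ

/-- For an ontology-mediated query `Q = (S, O, P)` with `O` a finite set of guarded TGDs and `P`
a 0-ary atomic query, the bounded-subdatabase condition holds iff the cost of `Q` is finite. -/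
theorem mainTheorem6 {R : Type u} (ar : R → ℕ) (Q : GuardedOMQ.AtomicOMQ ar) (hQ : Q.Guarded) :
    Q.BoundedSubdatabases ↔ Q.cost ≠ ⊤ := by

  constructor
  · rintro ⟨k, hk⟩
    let w := GuardedOMQ.schemaWidth ar Q.fullSchema
    -- `k * w` bounds the active domain of `D'`; the summand `w` covers the case `k = 0`.
    refine ne_top_of_le_ne_top (ENat.natCast_ne_top (Q.fullSchema.card * (k * w + w) ^ w))
      (sSup_le ?_)
    rintro _ ⟨D, hH, hD, htw, rfl⟩
    obtain ⟨D', hsub, hcard, hH'⟩ := hk D hD htw hH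
    have hD' : D'.IsOver Q.dataSchema := fun α hα => hD α (hsub hα)
    obtain ⟨T, hT, hht⟩ := GuardedOMQ.AtomicOMQ.exists_isDerivationTree hQ hD' hH'
    have hadom : D'.adom.card ≤ k * w + w :=
      (GuardedOMQ.AtomicOMQ.card_adom_le fun α hα =>
        Q.dataSchema_subset_fullSchema (hD' α hα)).trans
        ((Nat.mul_le_mul_right w hcard).trans (Nat.le_add_right _ _))
    have hcost : Q.costOn D ≤ T.height := sInf_le ⟨T, ⟨hT.1, hT.2.mono hsub⟩, rfl⟩
    refine hcost.trans (Nat.cast_le.2 (hht.trans ?_))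
    exact GuardedOMQ.card_factsOver_le hadom (Nat.le_add_left _ _)
  · intro hfin
    obtain ⟨c, hc⟩ := ENat.ne_top_iff_exists.1 hfin
    refine ⟨(Q.branching + 1) ^ c, fun D hD htw hH => ?_⟩
    have hle : Q.costOn D ≤ c := by
      rw [hc]
      exact le_sSup ⟨D, hH, hD, htw, rfl⟩
    -- As the infimum is below `c + 1`, some derivation tree has height at most `c`.
    have hlt : Q.costOn D < ((c + 1 : ℕ) : ℕ∞) :=
      hle.trans_lt (Nat.cast_lt.2 (Nat.lt_succ_self c))
    obtain ⟨_, ⟨T, hT, rfl⟩, hTc⟩ := sInf_lt_iff.1 hlt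
    obtain ⟨D', hsub, hcard, hent⟩ :=
      GuardedOMQ.AtomicOMQ.exists_subset_entails_of_nodesValid hT.2
        (Nat.le_of_lt_succ (Nat.cast_lt.1 hTc))
    rw [hT.1] at hent
    exact ⟨D', hsub, hcard, hent⟩
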